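/- **Setting.** Let $G=(V,E)$ be a finite simple undirected graph whose vertices are users, let $N(v)$ be the set of neighbors of $v$ and $N[v]=N(v)\cup\{v\}$, let $\mathbf t=(t_v)_{v\in V}\in\mathbb Z_{\ge 0}^V$, and let $\Delta\in\mathbb Z_{\ge 0}$. User $v$ holds an input $x_v\in\{0,\dots,\Delta\}$. A *protocol* has finitely many rounds; in each round every vertex may send a message to every vertex, determined by its input, its private coins (independent across vertices) and the messages it received in earlier rounds. At the end a designated vertex $w$ outputs an estimate $\tilde a\in\mathbb R$ of $a=\sum_{v\in V}x_v$, computed from its own input, its coins and the messages it received. (If the estimate is published, so that every vertex can compute it, then any vertex may be taken as $w$.) The *view* of a vertex consists of its input and all messages it sent and received; $\mathrm{view}^{S}_P(\mathbf x)$ is the joint view of the vertices in $S$. The protocol $P$ is $(\varepsilon,G,\mathbf t)$-*RTGDP* if for every $v\in V$, every $T\subseteq N(v)$ with $|T|\le t_v$, all inputs $\mathbf x_{-v}$ of the other users, all $x_v,x_v'\in\{0,\dots,\Delta\}$ and every (measurable) set $S$ of possible views, $$\Pr\big[\mathrm{view}_P^{V\setminus(N[v]\setminus T)}(x_v,\mathbf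 x_{-v})\in S\big]\le e^{\varepsilon}\,\Pr\big[\mathrm{view}_P^{V\setminus(N[v]\setminus T)}(x'_v,\mathbf x_{-v})\in S\big].$$ A $(2,\mathbf t)$-*robust packing* of $G$ is a set $U\subseteq V$ together with sets $T_u\subseteq N(u)$, $|T_u|\le t_u$ $(u\in U)$, such that the sets $N[u]\setminus T_u$, $u\in U$, are pairwise disjoint; $\rho(G)^{\mathbf t}$ denotes the largest possible $|U|$. **Theorem.** For every real $\varepsilon_0$ there is a constant $c>0$, depending only on $\varepsilon_0$, such that the following holds for all $G$, $\mathbf t$, $\Delta$ and all $\varepsilon\le\varepsilon_0$. Let $P$ be an $(\varepsilon,G,\mathbf t)$-RTGDP protocol for integer aggregation whose estimate is computed by a vertex $w$, and assume that $w$ is not fully trusted by all other users, i.e. there is a vertex $v\ne w$ such that $w\notin N(v)$ or $t_v\ge 1$. (This is automatic when $\rho(G)^{\mathbf t}\ge 2$; and if the estimate is published, a suitable $w$ exists unless $G$ is complete and $t_v=0$ for all $v$, or $|V|=1$.) Then the (worst-case over inputs) mean-square error of $P$ is at least $c\,\Delta^2\,\rho(G)^{\mathbf t}$: there is an input $\mathbf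 x\in\{0,\dots,\Delta\}^V$ with $$\mathbb E\big[(\tilde a-a)^2\big]\ \ge\ c\,\Delta^2\,\rho(G)^{\mathbf t}.$$ -/

import Mathlib

open MeasureTheory

namespace TrustGraph

/-- A synchronous interactive protocol among the vertices `V`, whose estimate is computed by the
vertex `outVertex`.  Vertex `u` holds an input in `X` and private coins in the probability space
`Ω u`; the coins of different vertices are independent.  In each of finitely many rounds every
vertex sends a message in `M` to every vertex (so broadcasting is possible, and "no message" can be
encoded by an element of `M`); what it sends is determined by its input, its coins and the messages
it received in the earlier rounds.  The alphabet `M` may be any measurable space; for a discrete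
alphabet take the σ-algebra of all subsets. -/
structure Protocol (V X M : Type*) (Ω : V → Type*) [MeasurableSpace M]
    [∀ u, MeasurableSpace (Ω u)] where
  /-- number of rounds -/
  rounds : ℕ
  /-- law of the private coins of each vertex -/
  coins : ∀ u, ProbabilityMeasure (Ω u)
  /-- `send u r a ω h v` is the message that `u` sends to `v` in round `r`, if `u` has input `a`
  and coins `ω`, and `h s w` is the message received from `w` in round `s < r` -/
  send : ∀ (u : V) (r : ℕ), X → Ω u → (Fin r → V → M) → V → M
  measurable_send : ∀ (u : V) (r : ℕ) (a : X),
    Measurable fun p : Ω u × (Fin r → V → M) => send u r a p.1 p.2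
  /-- the vertex that computes the estimate -/
  outVertex : V
  /-- the estimate, from the input, the coins and the received messages of `outVertex` -/
  output : X → Ω outVertex → (Fin rounds → V → M) → ℝ
  measurable_output : ∀ a : X,
    Measurable fun p : Ω outVertex × (Fin rounds → V → M) => output a p.1 p.2

namespace Protocol

variable {V X M : Type*} {Ω : V → Type*} [MeasurableSpace M] [∀ u, MeasurableSpace (Ω u)]

/-- `P.msg x ω r u v` is the message sent by `u` to `v` in round `r` when the protocol is run on
the inputs `x` with coins `ω`. -/
def msg (P : Protocol V X M Ω) (x : V → X) (ω : ∀ u, Ω u) (r : ℕ) (u v : V) : M :=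
  P.send u r (x u) (ω u) (fun (s : Fin r) (w : V) => msg P x ω s.1 w u) v
termination_by r
decreasing_by exact s.2

/-- The joint law of the independent private coins of all vertices. -/
noncomputable def law [Fintype V] (P : Protocol V X M Ω) : Measure (∀ u, Ω u) :=
  Measure.pi fun u => (P.coins u : Measure (Ω u))

/-- The view of `u`: its input, the messages it sent (by round and destination), and the messages
it received (by round and source). -/
def view (P : Protocol V X M Ω) (x : V → X) (ω : ∀ u, Ω u) (u : V) :
    X × (Fin P.rounds → V → M) × (Fin P.rounds → V → M) :=
  (x u, fun r v => P.msg x ω r u v, fun r v => P.msg x ω r v u)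

/-- The joint view of the set `A` of vertices. -/
def viewOn (P : Protocol V X M Ω) (A : Set V) (x : V → X) (ω : ∀ u, Ω u) :
    A → X × (Fin P.rounds → V → M) × (Fin P.rounds → V → M) :=
  fun u => P.view x ω u

/-- The estimate produced by the protocol. -/
def estimate (P : Protocol V X M Ω) (x : V → X) (ω : ∀ u, Ω u) : ℝ :=
  P.output (x P.outVertex) (ω P.outVertex) fun r v => P.msg x ω r v P.outVertex

end Protocol

/-- The closed neighborhood `N[v]`. -/
def closedNeighborSet {V : Type*} (G : SimpleGraph V) (v : V) : Set V :=
  insert v (G.neighborSet v)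

/-- `(ε, δ, G, t)`-Robust Trust Graph DP: for each vertex `v` and each `T ⊆ N(v)` of size at most
`t v`, the view of `V \ (N[v] \ T)` is `(ε, δ)`-DP with respect to the input of `v`, for all values
of the other inputs. -/
def IsRTGDP {V X M : Type*} {Ω : V → Type*} [Fintype V] [DecidableEq V] [MeasurableSpace X]
    [MeasurableSpace M] [∀ u, MeasurableSpace (Ω u)] (P : Protocol V X M Ω) (ε δ : ℝ)
    (G : SimpleGraph V) (t : V → ℕ) : Prop :=
  ∀ (v : V) (T : Finset V), (T : Set V) ⊆ G.neighborSet v → T.card ≤ t v →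
    ∀ (x : V → X) (a a' : X)
      (S : Set (((closedNeighborSet G v \ (T : Set V))ᶜ : Set V) →
        X × (Fin P.rounds → V → M) × (Fin P.rounds → V → M))), MeasurableSet S →
      P.law {ω | P.viewOn (closedNeighborSet G v \ (T : Set V))ᶜ (Function.update x v a) ω ∈ S} ≤
        ENNReal.ofReal (Real.exp ε) *
          P.law {ω | P.viewOn (closedNeighborSet G v \ (T : Set V))ᶜ
            (Function.update x v a') ω ∈ S} + ENNReal.ofReal δ

/-- The mean-square error, on the input dataset `x ∈ {0, …, Δ}^V`, of the protocol as an estimator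
of `∑ v, x v`. -/
noncomputable def mse {V M : Type*} {Ω : V → Type*} {Δ : ℕ} [Fintype V] [MeasurableSpace M]
    [∀ u, MeasurableSpace (Ω u)] (P : Protocol V (Fin (Δ + 1)) M Ω) (x : V → Fin (Δ + 1)) :
    ENNReal :=
  ∫⁻ ω, ENNReal.ofReal ((P.estimate x ω - ∑ v, ((x v : ℕ) : ℝ)) ^ 2) ∂P.law

/-- `U` and `(T u)` for `u ∈ U` form a `(2, t)`-robust packing of `G`. -/
def IsRobustPacking {V : Type*} (G : SimpleGraph V) (t : V → ℕ) (U : Finset V)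
    (T : V → Finset V) : Prop :=
  (∀ u ∈ U, (T u : Set V) ⊆ G.neighborSet u ∧ (T u).card ≤ t u) ∧
    (U : Set V).PairwiseDisjoint fun u => closedNeighborSet G u \ (T u : Set V)

/-- The largest size of a `(2, t)`-robust packing of `G`. -/
noncomputable def robustPackingNumber {V : Type*} (G : SimpleGraph V) (t : V → ℕ) : ℕ :=
  sSup {k | ∃ (U : Finset V) (T : V → Finset V), IsRobustPacking G t U T ∧ U.card = k}

end TrustGraph

/-!
The argument is Bayesian. Take a robust packing `U`, `(T u)` none of whose sets
`Q u = N[u] \ T u` contains the vertex that computes the estimate; since a vertex lies in at most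
one set of a packing, such a packing exists with at least half of the maximal size
(`exists_isRobustPacking_notMem`). Give the users of `U` independent uniform inputs in `{0, Δ}`
and all others the input `0`.

The data of `Q u` and of its complement are independent before the protocol starts, and
interaction keeps them independent conditionally on the messages exchanged between the two sides
(`Protocol.condIndepGiven_crossing`), as each message is a function of the data of one side and of
earlier messages. Hence an observer who knows everything outside `Q u`, and in particular the
estimate, knows no more about the input of `u` than these messages tell. They are part of the view
of the complement of `Q u`, so by privacy they never make the input `Δ` of `u` more than `exp ε` times
as likely as the input `0` (`Protocol.bitLaw_inter_le`). As both have prior probability `1 / 2`, the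
mean conditional variance is bounded below (`div_le_integral_indicator_sub_sq`).

Disjointness of the sets `Q u` makes the deviations of the inputs from their conditional
expectations orthogonal to each other and to the error of the best estimator, so that the conditional
variances add up (`sq_mul_sum_integral_sq_le`). This bounds the square error averaged over the random
inputs, hence the error on some input. Conditional independence is expressed through conditional
expectations, because the spaces of coins and messages need not be standard Borel and regular
conditional distributions need not exist.
-/

/-! ### Conditional independence -/

namespace TrustGraph

section CondIndep

variable {Θ : Type*}

theorem isPiSystem_image2_inter (A B : MeasurableSpace Θ) :
    IsPiSystem (Set.image2 (· ∩ ·) {s | MeasurableSet[A] s} {s | MeasurableSet[B] s}) := by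
  rintro _ ⟨a, ha, b, hb, rfl⟩ _ ⟨a', ha', b', hb', rfl⟩ _
  refine ⟨a ∩ a', MeasurableSet.inter ha ha', b ∩ b', MeasurableSet.inter hb hb', ?_⟩
  exact Set.inter_inter_inter_comm a a' b b'

theorem sup_eq_generateFrom_image2_inter (A B : MeasurableSpace Θ) :
    A ⊔ B = MeasurableSpace.generateFrom
      (Set.image2 (· ∩ ·) {s | MeasurableSet[A] s} {s | MeasurableSet[B] s}) := by
  apply le_antisymm
  · refine sup_le (fun s hs => ?_) (fun s hs => ?_)
    · exact MeasurableSpace.measurableSet_generateFrom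
        ⟨s, hs, Set.univ, MeasurableSet.univ, Set.inter_univ s⟩
    · exact MeasurableSpace.measurableSet_generateFrom
        ⟨Set.univ, MeasurableSet.univ, s, hs, Set.univ_inter s⟩
  · refine MeasurableSpace.generateFrom_le ?_
    rintro _ ⟨a, ha, b, hb, rfl⟩
    exact MeasurableSet.inter ((le_sup_left : A ≤ A ⊔ B) _ ha) ((le_sup_right : B ≤ A ⊔ B) _ hb)

/-- `A` and `B` are conditionally independent given `C`: the events of `A` have the same
conditional probability given `B ⊔ C` as given `C` alone. Unlike `ProbabilityTheory.CondIndep`, this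
makes sense on a space that is not standard Borel. -/
def CondIndepGiven {m₀ : MeasurableSpace Θ} (μ : Measure Θ) (A B C : MeasurableSpace Θ) : Prop :=
  ∀ s, MeasurableSet[A] s →
    μ[s.indicator (fun _ => (1 : ℝ)) | B ⊔ C] =ᵐ[μ] μ[s.indicator (fun _ => (1 : ℝ)) | C]

variable {A B C D E : MeasurableSpace Θ} {m₀ : MeasurableSpace Θ} {μ : Measure Θ}
  [IsProbabilityMeasure μ]

theorem condIndepGiven_bot (hA : A ≤ m₀) (hB : B ≤ m₀) (h : ProbabilityTheory.Indep A B μ) :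
    CondIndepGiven μ A B ⊥ := by
  intro s hs
  have hsm : StronglyMeasurable[A] (s.indicator (fun _ => (1 : ℝ))) :=
    (@stronglyMeasurable_const _ _ A _ _).indicator hs
  rw [sup_bot_eq, condExp_bot]
  exact condExp_indep_eq hA hB hsm h

/-- Conditional independence survives when one of the two sides, knowing `C`, announces
something. -/
theorem CondIndepGiven.sup_right (h : CondIndepGiven μ A B C) (hB : B ≤ m₀) (hC : C ≤ m₀)
    (hD : D ≤ B ⊔ C) : CondIndepGiven μ A B (C ⊔ D) := by
  intro s hs
  have hBC : B ⊔ C ≤ m₀ := sup_le hB hC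
  have e : B ⊔ (C ⊔ D) = B ⊔ C := by
    rw [← sup_assoc]; exact sup_eq_left.2 hD
  have hle : C ⊔ D ≤ B ⊔ C := sup_le le_sup_right hD
  rw [e]
  refine (h s hs).trans ?_
  calc μ[s.indicator (fun _ => (1 : ℝ)) | C]
      = μ[μ[s.indicator (fun _ => (1 : ℝ)) | C] | C ⊔ D] :=
        (condExp_of_stronglyMeasurable (sup_le hC (hD.trans hBC))
          (stronglyMeasurable_condExp.mono le_sup_left) integrable_condExp).symm
    _ =ᵐ[μ] μ[μ[s.indicator (fun _ => (1 : ℝ)) | B ⊔ C] | C ⊔ D] :=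
        condExp_congr_ae (h s hs).symm
    _ =ᵐ[μ] μ[s.indicator (fun _ => (1 : ℝ)) | C ⊔ D] := condExp_condExp_of_le hle hBC

theorem integrable_indicator_one {s : Set Θ} (hs : MeasurableSet s) :
    Integrable (s.indicator (fun _ => (1 : ℝ))) μ :=
  (integrable_const 1).indicator hs

/-- Averaging over a set of `C`, an indicator may be replaced by its conditional probability given
`C` inside a product with a `C`-measurable factor. -/
theorem setIntegral_indicator_mul_condExp {s c : Set Θ} (hC : C ≤ m₀) (hs : MeasurableSet s)
    (hc : MeasurableSet[C] c) (f : Θ → ℝ) :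
    ∫ x in c, μ[s.indicator (fun _ => (1 : ℝ)) | C] x * μ[f | C] x ∂μ =
      ∫ x in c ∩ s, μ[f | C] x ∂μ := by
  set q := μ[f | C]
  have hi : Integrable (s.indicator q) μ := integrable_condExp.indicator hs
  have e : s.indicator q = s.indicator (fun _ => (1 : ℝ)) * q := by
    ext x; by_cases hx : x ∈ s <;> simp [hx]
  have h1 : μ[s.indicator q | C] =ᵐ[μ] μ[s.indicator (fun _ => (1 : ℝ)) | C] * q := by
    rw [e]
    exact condExp_mul_of_stronglyMeasurable_right stronglyMeasurable_condExp
      (e ▸ hi) (integrable_indicator_one hs)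
  calc ∫ x in c, μ[s.indicator (fun _ => (1 : ℝ)) | C] x * q x ∂μ
      = ∫ x in c, μ[s.indicator q | C] x ∂μ :=
        integral_congr_ae (ae_restrict_of_ae (h1.mono fun x hx => by simpa using hx.symm))
    _ = ∫ x in c, s.indicator q x ∂μ := setIntegral_condExp hC hi hc
    _ = ∫ x in c ∩ s, q x ∂μ := setIntegral_indicator hs

theorem CondIndepGiven.symm (h : CondIndepGiven μ A B C) (hA : A ≤ m₀) (hB : B ≤ m₀)
    (hC : C ≤ m₀) : CondIndepGiven μ B A C := by
  intro s hs
  have hs0 : MeasurableSet s := hB s hs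
  have hAC : A ⊔ C ≤ m₀ := sup_le hA hC
  have hint : Integrable (s.indicator (fun _ => (1 : ℝ))) μ := integrable_indicator_one hs0
  set q := μ[s.indicator (fun _ => (1 : ℝ)) | C] with hq
  have hqi : Integrable q μ := integrable_condExp
  have huniv : ∫ x, q x ∂μ = ∫ x, s.indicator (fun _ => (1 : ℝ)) x ∂μ := integral_condExp hC
  have hqm : StronglyMeasurable[A ⊔ C] q := stronglyMeasurable_condExp.mono le_sup_right
  refine (ae_eq_condExp_of_forall_setIntegral_eq hAC hint (fun _ _ _ => hqi.integrableOn) ?_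
    hqm.aestronglyMeasurable).symm
  intro t ht _
  induction t, ht using MeasurableSpace.induction_on_inter
    (sup_eq_generateFrom_image2_inter A C) (isPiSystem_image2_inter A C) with
  | empty => simp
  | basic t ht =>
    obtain ⟨a, ha, c, hc, rfl⟩ := ht
    have ha0 : MeasurableSet a := hA a ha
    have hc0 : MeasurableSet c := hC c hc
    change ∫ x in a ∩ c, q x ∂μ = ∫ x in a ∩ c, s.indicator (fun _ => (1 : ℝ)) x ∂μ
    have hcs : MeasurableSet[B ⊔ C] (c ∩ s) :=
      MeasurableSet.inter ((le_sup_right : C ≤ B ⊔ C) _ hc) ((le_sup_left : B ≤ B ⊔ C) _ hs)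
    calc ∫ x in a ∩ c, q x ∂μ
        = ∫ x in c ∩ a, q x ∂μ := by rw [Set.inter_comm]
      _ = ∫ x in c, μ[a.indicator (fun _ => (1 : ℝ)) | C] x * q x ∂μ :=
          (setIntegral_indicator_mul_condExp hC ha0 hc _).symm
      _ = ∫ x in c, q x * μ[a.indicator (fun _ => (1 : ℝ)) | C] x ∂μ := by
          simp_rw [mul_comm]
      _ = ∫ x in c ∩ s, μ[a.indicator (fun _ => (1 : ℝ)) | C] x ∂μ :=
          setIntegral_indicator_mul_condExp hC hs0 hc _
      _ = ∫ x in c ∩ s, μ[a.indicator (fun _ => (1 : ℝ)) | B ⊔ C] x ∂μ :=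
          integral_congr_ae (ae_restrict_of_ae (h a ha).symm)
      _ = ∫ x in c ∩ s, a.indicator (fun _ => (1 : ℝ)) x ∂μ :=
          setIntegral_condExp (sup_le hB hC) (integrable_indicator_one ha0) hcs
      _ = ∫ x in a ∩ c, s.indicator (fun _ => (1 : ℝ)) x ∂μ := by
          rw [setIntegral_indicator ha0, setIntegral_indicator hs0]
          congr 2
          rw [Set.inter_comm a c, Set.inter_right_comm]
  | compl t ht ih =>
    have ht0 := hAC t ht
    have ih' := ih (measure_lt_top _ _)
    have e1 := integral_add_compl ht0 hqi
    have e2 := integral_add_compl ht0 hint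
    linarith
  | iUnion f hd hm ih =>
    rw [integral_iUnion (fun i => hAC _ (hm i)) hd hqi.integrableOn,
      integral_iUnion (fun i => hAC _ (hm i)) hd hint.integrableOn]
    exact tsum_congr fun i => ih i (measure_lt_top _ _)

/-- The two-sided form of `CondIndepGiven.sup_right`: one round of a conversation between `A` and
`B`. -/
theorem CondIndepGiven.sup (h : CondIndepGiven μ A B C) (hA : A ≤ m₀) (hB : B ≤ m₀)
    (hC : C ≤ m₀) (hD : D ≤ A ⊔ C) (hE : E ≤ B ⊔ C) :
    CondIndepGiven μ A B (C ⊔ (D ⊔ E)) := by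
  have h1 := ((h.symm hA hB hC).sup_right hA hC hD).symm hB hA
    (sup_le hC (hD.trans (sup_le hA hC)))
  have h2 := h1.sup_right hB (sup_le hC (hD.trans (sup_le hA hC)))
    (hE.trans (sup_le_sup_left le_sup_left B))
  rwa [sup_assoc] at h2

end CondIndep

end TrustGraph

/-! ### Transcripts of a protocol run on random inputs -/

namespace TrustGraph

/-- The information held by the coalition `Q` when vertex `v` holds the information `F v`. -/
abbrev coalition {Θ V : Type*} (F : V → MeasurableSpace Θ) (Q : Set V) : MeasurableSpace Θ :=
  ⨆ v ∈ Q, F v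

theorem le_coalition {Θ V : Type*} (F : V → MeasurableSpace Θ) {Q : Set V} {v : V} (hv : v ∈ Q) :
    F v ≤ coalition F Q :=
  le_iSup₂_of_le v hv le_rfl

theorem coalition_le {Θ V : Type*} {F : V → MeasurableSpace Θ} {m₀ : MeasurableSpace Θ}
    (hF : ∀ v, F v ≤ m₀) (Q : Set V) : coalition F Q ≤ m₀ :=
  iSup₂_le fun v _ => hF v

namespace Protocol

variable {V X M Θ : Type*} {Ω : V → Type*} [MeasurableSpace M] [∀ u, MeasurableSpace (Ω u)]

/-- The information carried by the messages of the first `k` rounds that cross the boundary of the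
set `Q` of vertices, in either direction, when the inputs `x θ` and the coins `η θ` depend on a
point `θ` of a sample space. -/
abbrev crossing (P : Protocol V X M Ω) (x : Θ → V → X) (η : Θ → ∀ u, Ω u) (Q : Set V) (k : ℕ) :
    MeasurableSpace Θ :=
  ⨆ (r) (_ : r < k) (i) (j) (_ : ¬(i ∈ Q ↔ j ∈ Q)),
    MeasurableSpace.comap (fun θ => P.msg (x θ) (η θ) r i j) inferInstance

variable {P : Protocol V X M Ω} {x : Θ → V → X} {η : Θ → ∀ u, Ω u} {Q : Set V}

theorem comap_msg_le_crossing {r k : ℕ} {i j : V} (hr : r < k) (hij : ¬(i ∈ Q ↔ j ∈ Q)) :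
    MeasurableSpace.comap (fun θ => P.msg (x θ) (η θ) r i j) inferInstance ≤
      P.crossing x η Q k :=
  le_iSup₂_of_le r hr <| le_iSup₂_of_le i j <| le_iSup_of_le hij le_rfl

theorem crossing_le {m : MeasurableSpace Θ} {k : ℕ}
    (h : ∀ r < k, ∀ i j, ¬(i ∈ Q ↔ j ∈ Q) →
      Measurable[m] fun θ => P.msg (x θ) (η θ) r i j) : P.crossing x η Q k ≤ m :=
  iSup₂_le fun r hr => iSup₂_le fun i j => iSup_le fun hij =>
    measurable_iff_comap_le.1 (h r hr i j hij)

theorem crossing_zero : P.crossing x η Q 0 = ⊥ :=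
  le_bot_iff.1 (crossing_le fun r hr => absurd hr r.not_lt_zero)

theorem crossing_compl (k : ℕ) : P.crossing x η Qᶜ k = P.crossing x η Q k := by
  simp only [crossing, Set.mem_compl_iff, not_iff_not]

theorem crossing_mono {k l : ℕ} (h : k ≤ l) : P.crossing x η Q k ≤ P.crossing x η Q l :=
  iSup₂_le fun r hr => le_iSup₂_of_le r (hr.trans_le h) le_rfl

/-- The messages that leave `Q` in round `k`. -/
abbrev outgoing (P : Protocol V X M Ω) (x : Θ → V → X) (η : Θ → ∀ u, Ω u) (Q : Set V) (k : ℕ) :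
    MeasurableSpace Θ :=
  ⨆ (i) (_ : i ∈ Q) (j) (_ : j ∉ Q),
    MeasurableSpace.comap (fun θ => P.msg (x θ) (η θ) k i j) inferInstance

theorem crossing_succ (k : ℕ) :
    P.crossing x η Q (k + 1) =
      P.crossing x η Q k ⊔ (P.outgoing x η Q k ⊔ P.outgoing x η Qᶜ k) := by
  apply le_antisymm
  · refine crossing_le fun r hr i j hij => measurable_iff_comap_le.2 ?_
    rcases Nat.lt_succ_iff_lt_or_eq.1 hr with h | rfl
    · exact (comap_msg_le_crossing h hij).trans le_sup_left
    · by_cases hi : i ∈ Q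
      · have hj : j ∉ Q := fun hj => hij (iff_of_true hi hj)
        exact le_sup_of_le_right <| le_sup_of_le_left <|
          le_iSup₂_of_le i hi <| le_iSup₂_of_le j hj le_rfl
      · have hj : j ∈ Q := by_contra fun hj => hij (iff_of_false hi hj)
        exact le_sup_of_le_right <| le_sup_of_le_right <|
          le_iSup₂_of_le i hi <| le_iSup₂_of_le j (not_not.2 hj) le_rfl
  · refine sup_le (crossing_mono k.le_succ) (sup_le ?_ ?_)
    · exact iSup₂_le fun i hi => iSup₂_le fun j hj =>
        comap_msg_le_crossing k.lt_succ_self fun h => hj (h.1 hi)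
    · exact iSup₂_le fun i hi => iSup₂_le fun j hj =>
        comap_msg_le_crossing k.lt_succ_self fun h => hi (h.2 (not_not.1 hj))

variable [Countable X] [MeasurableSpace X] [MeasurableSingletonClass X]

/-- The coalition `Q` can compute what its members send from its own information and the messages
that crossed its boundary earlier. -/
theorem measurable_msg_of_mem {F : V → MeasurableSpace Θ} (hx : ∀ v, Measurable[F v] fun θ => x θ v)
    (hη : ∀ v, Measurable[F v] fun θ => η θ v) {k : ℕ} (r : ℕ) (hr : r ≤ k) {i : V} (hi : i ∈ Q)
    (j : V) : Measurable[coalition F Q ⊔ P.crossing x η Q k]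
      fun θ => P.msg (x θ) (η θ) r i j := by
  induction r using Nat.strong_induction_on generalizing i j with
  | _ r ih =>
    let _ : MeasurableSpace Θ := coalition F Q ⊔ P.crossing x η Q k
    have hF : F i ≤ coalition F Q ⊔ P.crossing x η Q k := (le_coalition F hi).trans le_sup_left
    have hsend : Measurable fun p : X × (Ω i × (Fin r → V → M)) => P.send i r p.1 p.2.1 p.2.2 :=
      measurable_from_prod_countable_right fun a => P.measurable_send i r a
    have hrec : Measurable fun θ => fun (s : Fin r) (w : V) => P.msg (x θ) (η θ) s.1 w i := by
      refine measurable_pi_lambda _ fun s => measurable_pi_lambda _ fun w => ?_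
      by_cases hw : w ∈ Q
      · exact ih s.1 s.2 (s.2.le.trans hr) hw i
      · exact measurable_iff_comap_le.2 <|
          (comap_msg_le_crossing (s.2.trans_le hr) fun h => hw (h.2 hi)).trans le_sup_right
    have e : (fun θ => P.msg (x θ) (η θ) r i j) = fun θ => P.send i r (x θ i) (η θ i)
        (fun (s : Fin r) (w : V) => P.msg (x θ) (η θ) s.1 w i) j :=
      funext fun θ => by rw [msg]
    rw [e]
    exact (measurable_pi_apply j).comp
      (hsend.comp (((hx i).mono hF le_rfl).prodMk (((hη i).mono hF le_rfl).prodMk hrec)))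

/-- A coalition can compute all messages that its members send or receive. -/
theorem measurable_msg_of_mem_or_mem {F : V → MeasurableSpace Θ}
    (hx : ∀ v, Measurable[F v] fun θ => x θ v)
    (hη : ∀ v, Measurable[F v] fun θ => η θ v) {k r : ℕ} (hr : r < k) {i j : V}
    (hij : i ∈ Q ∨ j ∈ Q) : Measurable[coalition F Q ⊔ P.crossing x η Q k]
      fun θ => P.msg (x θ) (η θ) r i j := by
  by_cases hi : i ∈ Q
  · exact measurable_msg_of_mem hx hη r hr.le hi j
  · exact measurable_iff_comap_le.2 <|
      (comap_msg_le_crossing hr fun h => hi (h.2 (hij.resolve_left hi))).trans le_sup_right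

theorem measurable_estimate {F : V → MeasurableSpace Θ} (hx : ∀ v, Measurable[F v] fun θ => x θ v)
    (hη : ∀ v, Measurable[F v] fun θ => η θ v) (hQ : P.outVertex ∈ Q) :
    Measurable[coalition F Q ⊔ P.crossing x η Q P.rounds] fun θ => P.estimate (x θ) (η θ) := by
  let _ : MeasurableSpace Θ := coalition F Q ⊔ P.crossing x η Q P.rounds
  have hF : F P.outVertex ≤ coalition F Q ⊔ P.crossing x η Q P.rounds :=
    (le_coalition F hQ).trans le_sup_left
  have hout : Measurable fun p : X × (Ω P.outVertex × (Fin P.rounds → V → M)) =>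
      P.output p.1 p.2.1 p.2.2 :=
    measurable_from_prod_countable_right fun a => P.measurable_output a
  have hrec : Measurable fun θ => fun (s : Fin P.rounds) (w : V) =>
      P.msg (x θ) (η θ) s.1 w P.outVertex :=
    measurable_pi_lambda _ fun s => measurable_pi_lambda _ fun w =>
      measurable_msg_of_mem_or_mem hx hη s.2 (Or.inr hQ)
  exact hout.comp (((hx _).mono hF le_rfl).prodMk (((hη _).mono hF le_rfl).prodMk hrec))

variable {F : V → MeasurableSpace Θ} {m₀ : MeasurableSpace Θ}

theorem crossing_le_of_le (hx : ∀ v, Measurable[F v] fun θ => x θ v)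
    (hη : ∀ v, Measurable[F v] fun θ => η θ v) (hF : ∀ v, F v ≤ m₀) (k : ℕ) :
    P.crossing x η Q k ≤ m₀ := by
  refine crossing_le fun r hr i j _ => ?_
  have := measurable_msg_of_mem (P := P) (Q := Set.univ) hx hη (k := k) r hr.le (Set.mem_univ i) j
  refine this.mono (sup_le (coalition_le hF _) (crossing_le fun r hr i j hij => ?_)) le_rfl
  exact absurd (iff_of_true (Set.mem_univ i) (Set.mem_univ j)) hij

/-- For disjoint coalitions `Q` and `R`, the outside of `R` sees everything that crosses the
boundary of `Q`. -/
theorem crossing_le_coalition_compl_sup (hx : ∀ v, Measurable[F v] fun θ => x θ v)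
    (hη : ∀ v, Measurable[F v] fun θ => η θ v) {R : Set V} (hQR : Disjoint Q R) (k : ℕ) :
    P.crossing x η Q k ≤ coalition F Rᶜ ⊔ P.crossing x η R k := by
  refine crossing_le fun r hr i j hij => ?_
  rw [← crossing_compl]
  refine measurable_msg_of_mem_or_mem hx hη hr ?_
  by_cases hi : i ∈ Q
  · exact Or.inl (hQR.notMem_of_mem_left hi)
  · exact Or.inr (hQR.notMem_of_mem_left (by_contra fun hj => hij (iff_of_false hi hj)))

/-- Private data of a set `Q` of vertices and of its complement, independent at the start, stay
independent conditionally on all messages exchanged between `Q` and its complement. -/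
theorem condIndepGiven_crossing {μ : Measure Θ} [IsProbabilityMeasure μ]
    (hx : ∀ v, Measurable[F v] fun θ => x θ v)
    (hη : ∀ v, Measurable[F v] fun θ => η θ v) (hF : ∀ v, F v ≤ m₀)
    (hind : ProbabilityTheory.iIndep F μ) (k : ℕ) :
    CondIndepGiven μ (coalition F Q) (coalition F Qᶜ) (P.crossing x η Q k) := by
  have hA := coalition_le hF Q
  have hB := coalition_le hF Qᶜ
  induction k with
  | zero =>
    rw [crossing_zero]
    exact condIndepGiven_bot hA hB
      (ProbabilityTheory.indep_iSup_of_disjoint hF hind disjoint_compl_right)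
  | succ k ih =>
    rw [crossing_succ]
    refine ih.sup hA hB (crossing_le_of_le hx hη hF k) ?_ ?_
    · exact iSup₂_le fun i hi => iSup₂_le fun j _ =>
        measurable_iff_comap_le.1 (measurable_msg_of_mem hx hη k le_rfl hi j)
    · rw [← crossing_compl]
      exact iSup₂_le fun i hi => iSup₂_le fun j _ =>
        measurable_iff_comap_le.1 (measurable_msg_of_mem hx hη k le_rfl hi j)

end Protocol

end TrustGraph

/-! ### Estimating a sum of conditionally independent variables -/

namespace TrustGraph

section SquareError

variable {Θ ι : Type*} {m : MeasurableSpace Θ} {m₀ : MeasurableSpace Θ} {μ : Measure Θ}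
  [IsProbabilityMeasure μ]

theorem integral_sub_mul_eq_zero {f p g : Θ → ℝ} (hm : m ≤ m₀)
    (hf : MemLp f 2 μ) (hp : MemLp p 2 μ) (hg : MemLp g 2 μ)
    (hgm : StronglyMeasurable[m] g) (h : μ[f | m] =ᵐ[μ] p) :
    ∫ θ, (f θ - p θ) * g θ ∂μ = 0 := by
  have hfg : Integrable (f * g) μ := hf.integrable_mul hg
  have hpg : Integrable (p * g) μ := hp.integrable_mul hg
  have e : μ[f * g | m] =ᵐ[μ] p * g :=
    (condExp_mul_of_stronglyMeasurable_right hgm hfg (hf.integrable one_le_two)).trans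
      (h.mul (Filter.EventuallyEq.refl _ g))
  have e2 : ∫ θ, (f * g) θ ∂μ = ∫ θ, (p * g) θ ∂μ := by
    rw [← integral_condExp hm]
    exact integral_congr_ae e
  calc ∫ θ, (f θ - p θ) * g θ ∂μ = ∫ θ, ((f * g) θ - (p * g) θ) ∂μ := by
        simp only [Pi.mul_apply, sub_mul]
    _ = 0 := by rw [integral_sub hfg hpg, e2, sub_self]

/-- If, for each `u`, the estimator `a`, the variables `b v` with `v ≠ u` and all the conditional
expectations `p v` are known to the observer `m u`, to whom `b u` has conditional expectation `p u`,
then the deviations `b u - p u` are orthogonal to each other and to `a - D * ∑ u, p u`. Hence the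
square error of `a` as an estimator of `D * ∑ u, b u` is at least the sum of the mean conditional
variances. -/
theorem sq_mul_sum_integral_sq_le {m : ι → MeasurableSpace Θ} {U : Finset ι} {a : Θ → ℝ}
    {b p : ι → Θ → ℝ} (D : ℝ) (hm : ∀ u ∈ U, m u ≤ m₀) (ha : MemLp a 2 μ)
    (hb : ∀ u ∈ U, MemLp (b u) 2 μ) (ham : ∀ u ∈ U, StronglyMeasurable[m u] a)
    (hbm : ∀ u ∈ U, ∀ v ∈ U, v ≠ u → StronglyMeasurable[m u] (b v))
    (hpm : ∀ u ∈ U, ∀ v ∈ U, StronglyMeasurable[m u] (p v))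
    (hp : ∀ u ∈ U, μ[b u | m u] =ᵐ[μ] p u) :
    D ^ 2 * ∑ u ∈ U, ∫ θ, (b u θ - p u θ) ^ 2 ∂μ ≤
      ∫ θ, (a θ - D * ∑ u ∈ U, b u θ) ^ 2 ∂μ := by
  classical
  have hp2 : ∀ u ∈ U, MemLp (p u) 2 μ := fun u hu =>
    ((hb u hu).condExp (m := m u) one_le_two).ae_eq (hp u hu)
  have hd2 : ∀ u ∈ U, MemLp (fun θ => b u θ - p u θ) 2 μ := fun u hu => (hb u hu).sub (hp2 u hu)
  set h : Θ → ℝ := fun θ => a θ - D * ∑ u ∈ U, p u θ with hh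
  have hh2 : MemLp h 2 μ := ha.sub ((memLp_finsetSum U hp2).const_mul D)
  have hhm : ∀ u ∈ U, StronglyMeasurable[m u] h := fun u hu =>
    (ham u hu).sub ((Finset.stronglyMeasurable_fun_sum U (hpm u hu)).const_mul D)
  have hcross : ∀ u ∈ U, ∀ v ∈ U, v ≠ u →
      ∫ θ, (b u θ - p u θ) * (b v θ - p v θ) ∂μ = 0 := fun u hu v hv huv =>
    integral_sub_mul_eq_zero (hm u hu) (hb u hu) (hp2 u hu) (hd2 v hv)
      ((hbm u hu v hv huv).sub (hpm u hu v hv)) (hp u hu)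
  have hest : ∀ u ∈ U, ∫ θ, (b u θ - p u θ) * h θ ∂μ = 0 := fun u hu =>
    integral_sub_mul_eq_zero (hm u hu) (hb u hu) (hp2 u hu) hh2 (hhm u hu) (hp u hu)
  have hZ2 : MemLp (fun θ => ∑ u ∈ U, (b u θ - p u θ)) 2 μ := memLp_finsetSum U hd2
  have hdd : ∀ u ∈ U, ∀ v ∈ U, Integrable (fun θ => (b u θ - p u θ) * (b v θ - p v θ)) μ :=
    fun u hu v hv => (hd2 u hu).integrable_mul (hd2 v hv)
  have hdh : ∀ u ∈ U, Integrable (fun θ => (b u θ - p u θ) * h θ) μ :=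
    fun u hu => (hd2 u hu).integrable_mul hh2
  have hZZ : ∫ θ, (∑ u ∈ U, (b u θ - p u θ)) ^ 2 ∂μ = ∑ u ∈ U, ∫ θ, (b u θ - p u θ) ^ 2 ∂μ := by
    simp_rw [sq, Finset.sum_mul_sum]
    rw [integral_finsetSum U fun u hu => integrable_finsetSum U fun v hv => hdd u hu v hv]
    refine Finset.sum_congr rfl fun u hu => ?_
    rw [integral_finsetSum U fun v hv => hdd u hu v hv]
    exact Finset.sum_eq_single_of_mem u hu (hcross u hu)
  have hZh : ∫ θ, (∑ u ∈ U, (b u θ - p u θ)) * h θ ∂μ = 0 := by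
    simp_rw [Finset.sum_mul]
    rw [integral_finsetSum U hdh]
    exact Finset.sum_eq_zero hest
  have hE2 : MemLp (fun θ => a θ - D * ∑ u ∈ U, b u θ) 2 μ :=
    ha.sub ((memLp_finsetSum U hb).const_mul D)
  have hi1 : Integrable (fun θ => D ^ 2 * (∑ u ∈ U, (b u θ - p u θ)) ^ 2) μ :=
    hZ2.integrable_sq.const_mul _
  have hi2 : Integrable (fun θ => 2 * D * ((∑ u ∈ U, (b u θ - p u θ)) * h θ)) μ :=
    (hZ2.integrable_mul hh2).const_mul _
  calc D ^ 2 * ∑ u ∈ U, ∫ θ, (b u θ - p u θ) ^ 2 ∂μ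
      = ∫ θ, (D ^ 2 * (∑ u ∈ U, (b u θ - p u θ)) ^ 2 -
          2 * D * ((∑ u ∈ U, (b u θ - p u θ)) * h θ)) ∂μ := by
        rw [integral_sub hi1 hi2, integral_const_mul, integral_const_mul, hZZ, hZh]
        ring
    _ ≤ ∫ θ, (a θ - D * ∑ u ∈ U, b u θ) ^ 2 ∂μ := by
        refine integral_mono (hi1.sub hi2) hE2.integrable_sq fun θ => ?_
        have := sq_nonneg (h θ)
        simp only [hh, Finset.sum_sub_distrib] at this ⊢
        linarith

/-- If an observer `m` finds the event `s` at most `K` times as likely as its complement, whatever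
it sees, then no function of what it sees approximates the indicator of `s` well. -/
theorem div_le_integral_indicator_sub_sq {s : Set Θ} {p : Θ → ℝ} {K : ℝ} (hm : m ≤ m₀)
    (hs : MeasurableSet s) (hK : 0 < K)
    (h : ∀ c, MeasurableSet[m] c → μ (s ∩ c) ≤ ENNReal.ofReal K * μ (sᶜ ∩ c))
    (hpm : StronglyMeasurable[m] p) (hp : MemLp p 2 μ) :
    μ.real s / (K + 1) ≤ ∫ θ, (s.indicator (fun _ => (1 : ℝ)) θ - p θ) ^ 2 ∂μ := by
  have hp2 : Integrable (fun θ => p θ ^ 2) μ := hp.integrable_sq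
  have h1p : Integrable (fun θ => (1 - p θ) ^ 2) μ := ((memLp_const 1).sub hp).integrable_sq
  have htrim : (μ.restrict s).trim hm ≤ ENNReal.ofReal K • (μ.restrict sᶜ).trim hm := by
    refine Measure.le_iff.2 fun c hc => ?_
    rw [Measure.smul_apply, trim_measurableSet_eq hm hc, trim_measurableSet_eq hm hc,
      Measure.restrict_apply (hm c hc), Measure.restrict_apply (hm c hc), Set.inter_comm c,
      Set.inter_comm c]
    exact h c hc
  have hlint : ∫⁻ θ in s, ENNReal.ofReal (p θ ^ 2) ∂μ ≤
      ENNReal.ofReal K * ∫⁻ θ in sᶜ, ENNReal.ofReal (p θ ^ 2) ∂μ := by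
    have hmeas : Measurable[m] fun θ => ENNReal.ofReal (p θ ^ 2) :=
      (hpm.measurable.pow_const 2).ennreal_ofReal
    rw [← lintegral_trim hm hmeas, ← lintegral_trim hm hmeas, ← smul_eq_mul,
      ← lintegral_smul_measure]
    exact lintegral_mono' htrim le_rfl
  have hreal : ∫ θ in s, p θ ^ 2 ∂μ ≤ K * ∫ θ in sᶜ, p θ ^ 2 ∂μ := by
    rw [← ofReal_integral_eq_lintegral_ofReal hp2.integrableOn
        (Filter.Eventually.of_forall fun θ => sq_nonneg (p θ)),
      ← ofReal_integral_eq_lintegral_ofReal hp2.integrableOn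
        (Filter.Eventually.of_forall fun θ => sq_nonneg (p θ)), ← ENNReal.ofReal_mul hK.le] at hlint
    exact (ENNReal.ofReal_le_ofReal_iff
      (mul_nonneg hK.le (integral_nonneg fun θ => sq_nonneg (p θ)))).1 hlint
  have hint : Integrable (fun θ => (s.indicator (fun _ => (1 : ℝ)) θ - p θ) ^ 2) μ :=
    (((memLp_const (1 : ℝ)).indicator hs).sub hp).integrable_sq
  have e1 : ∫ θ in s, (s.indicator (fun _ => (1 : ℝ)) θ - p θ) ^ 2 ∂μ =
      ∫ θ in s, (1 - p θ) ^ 2 ∂μ :=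
    setIntegral_congr_fun hs fun θ hθ => by simp [Set.indicator_of_mem hθ]
  have e2 : ∫ θ in sᶜ, (s.indicator (fun _ => (1 : ℝ)) θ - p θ) ^ 2 ∂μ =
      ∫ θ in sᶜ, p θ ^ 2 ∂μ :=
    setIntegral_congr_fun hs.compl fun θ hθ => by simp [Set.indicator_of_notMem hθ]
  -- `1 / (K + 1)` is the minimum over `y` of `(1 - y) ^ 2 + y ^ 2 / K`.
  have e3 : μ.real s / (K + 1) ≤ ∫ θ in s, ((1 - p θ) ^ 2 + p θ ^ 2 / K) ∂μ := by
    calc μ.real s / (K + 1) = ∫ _ in s, 1 / (K + 1) ∂μ := by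
          rw [setIntegral_const, smul_eq_mul, mul_one_div]
      _ ≤ ∫ θ in s, ((1 - p θ) ^ 2 + p θ ^ 2 / K) ∂μ := by
          refine integral_mono (integrable_const _)
            (h1p.integrableOn.add (hp2.integrableOn.div_const K)) fun θ => ?_
          have : (1 - p θ) ^ 2 + p θ ^ 2 / K - 1 / (K + 1) =
              ((K + 1) * p θ - K) ^ 2 / (K * (K + 1)) := by
            field_simp
            ring
          have h0 : 0 ≤ ((K + 1) * p θ - K) ^ 2 / (K * (K + 1)) := by positivity
          dsimp only
          linarith
  rw [integral_add h1p.integrableOn (hp2.integrableOn.div_const K), integral_div] at e3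
  have e4 : (∫ θ in s, p θ ^ 2 ∂μ) / K ≤ ∫ θ in sᶜ, p θ ^ 2 ∂μ := by
    rw [div_le_iff₀ hK, mul_comm]
    exact hreal
  rw [← integral_add_compl hs hint, e1, e2]
  linarith

end SquareError

end TrustGraph

/-! ### Random inputs and privacy -/

namespace TrustGraph

/-- The law of a fair coin. -/
noncomputable def fairCoin : Measure Bool := (PMF.uniformOfFintype Bool).toMeasure

instance : IsProbabilityMeasure fairCoin := by unfold fairCoin; infer_instance

theorem fairCoin_singleton (b : Bool) : fairCoin {b} = 2⁻¹ := by
  simp [fairCoin, PMF.toMeasure_apply_singleton _ _ (measurableSet_singleton b)]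

theorem measurePreserving_not : MeasurePreserving not fairCoin fairCoin := by
  refine ⟨measurable_of_finite _, Measure.ext_of_singleton fun b => ?_⟩
  rw [Measure.map_apply (measurable_of_finite _) (measurableSet_singleton b)]
  have : not ⁻¹' {b} = {!b} := by ext c; cases b <;> cases c <;> simp
  rw [this, fairCoin_singleton, fairCoin_singleton]

section RandomInput

variable {V : Type*}

theorem measurePreserving_update_not [Fintype V] [DecidableEq V] (u : V) :
    MeasurePreserving (fun b : V → Bool => Function.update b u (!b u))
      (Measure.pi fun _ => fairCoin) (Measure.pi fun _ => fairCoin) := by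
  have h := measurePreserving_pi (fun _ : V => fairCoin) (fun _ : V => fairCoin)
    (f := fun v => if v = u then not else id) fun v => by
      split_ifs
      · exact measurePreserving_not
      · exact MeasurePreserving.id _
  convert h using 3 with b v
  by_cases hv : v = u
  · subst hv; simp
  · simp [hv]

/-- The input dataset in which the users of `U` hold `Δ` or `0`, according to the bits `b`, and all
others hold `0`. -/
def bitInput (Δ : ℕ) [DecidableEq V] (U : Finset V) (b : V → Bool) (v : V) : Fin (Δ + 1) :=
  if v ∈ U ∧ b v then Fin.last Δ else 0

theorem bitInput_update [DecidableEq V] {Δ : ℕ} {U : Finset V} (b : V → Bool) {u : V} (hu : u ∈ U)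
    (c : Bool) : bitInput Δ U (Function.update b u c) =
      Function.update (bitInput Δ U b) u (if c then Fin.last Δ else 0) := by
  ext v
  by_cases hv : v = u
  · subst hv; simp [bitInput, hu]
  · simp [bitInput, hv]

theorem sum_bitInput [Fintype V] [DecidableEq V] (Δ : ℕ) (U : Finset V) (b : V → Bool) :
    ∑ v, ((bitInput Δ U b v : ℕ) : ℝ) = Δ * ∑ u ∈ U, if b u then 1 else 0 := by
  rw [Finset.mul_sum, ← Finset.sum_subset (Finset.subset_univ U)]
  · refine Finset.sum_congr rfl fun u hu => ?_
    by_cases hb : b u <;> simp [bitInput, hu, hb]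
  · intro v _ hv
    simp [bitInput, hv]

variable {Ω : V → Type*} [∀ u, MeasurableSpace (Ω u)]

/-- What vertex `v` alone knows at the start: its random bit and its coins. -/
abbrev privateInfo (Ω : V → Type*) [∀ u, MeasurableSpace (Ω u)] (v : V) :
    MeasurableSpace ((V → Bool) × ∀ u, Ω u) :=
  MeasurableSpace.comap (fun θ => θ.1 v) inferInstance ⊔
    MeasurableSpace.comap (fun θ => θ.2 v) inferInstance

theorem measurable_fst_privateInfo (v : V) :
    Measurable[privateInfo Ω v] fun θ : (V → Bool) × ∀ u, Ω u => θ.1 v :=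
  measurable_iff_comap_le.2 le_sup_left

theorem measurableSet_bit (v : V) :
    MeasurableSet[privateInfo Ω v] {θ : (V → Bool) × ∀ u, Ω u | θ.1 v = true} :=
  measurable_fst_privateInfo v (measurableSet_singleton true)

theorem measurable_snd_privateInfo (v : V) :
    Measurable[privateInfo Ω v] fun θ : (V → Bool) × ∀ u, Ω u => θ.2 v :=
  measurable_iff_comap_le.2 le_sup_right

theorem privateInfo_le (v : V) : privateInfo Ω v ≤ Prod.instMeasurableSpace :=
  sup_le ((measurable_pi_apply v).comp measurable_fst).comap_le
    ((measurable_pi_apply v).comp measurable_snd).comap_le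

theorem iIndep_privateInfo [Fintype V] (ν : V → Measure Bool) (c : ∀ u, Measure (Ω u))
    [∀ v, IsProbabilityMeasure (ν v)] [∀ v, IsProbabilityMeasure (c v)] :
    ProbabilityTheory.iIndep (privateInfo Ω) ((Measure.pi ν).prod (Measure.pi c)) := by
  refine ProbabilityTheory.iIndepSets.iIndep privateInfo_le _ (fun v => isPiSystem_image2_inter _ _)
    (fun v => sup_eq_generateFrom_image2_inter _ _) ?_
  rw [ProbabilityTheory.iIndepSets_iff]
  intro S f hf
  have hf' : ∀ v, ∃ s : Set Bool, ∃ t : Set (Ω v), v ∈ S →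
      f v = ((fun b : V → Bool => b v) ⁻¹' s) ×ˢ ((fun ω : ∀ u, Ω u => ω v) ⁻¹' t) := by
    intro v
    by_cases hv : v ∈ S
    · obtain ⟨_, ⟨s, _, rfl⟩, _, ⟨t, _, rfl⟩, h⟩ := hf v hv
      exact ⟨s, t, fun _ => h.symm⟩
    · exact ⟨∅, ∅, fun h => absurd h hv⟩
  choose s t hst using hf'
  have hone : ∀ v ∈ S, ((Measure.pi ν).prod (Measure.pi c)) (f v) = ν v (s v) * c v (t v) := by
    intro v hv
    have h1 := Measure.pi_pi_finset (μ := ν) s {v}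
    have h2 := Measure.pi_pi_finset (μ := c) t {v}
    simp only [Finset.coe_singleton, Set.singleton_pi, Finset.prod_singleton] at h1 h2
    rw [hst v hv, Measure.prod_prod]
    exact congrArg₂ _ h1 h2
  have hall : ⋂ v ∈ S, f v = (Set.pi S s) ×ˢ (Set.pi S t) := by
    ext θ
    simp only [Set.mem_iInter, Set.mem_prod, Set.mem_pi, Finset.mem_coe]
    constructor
    · intro h
      have h' : ∀ v ∈ S, θ.1 v ∈ s v ∧ θ.2 v ∈ t v := fun v hv => by
        have := h v hv
        rwa [hst v hv] at this
      exact ⟨fun v hv => (h' v hv).1, fun v hv => (h' v hv).2⟩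
    · intro h v hv
      rw [hst v hv]
      exact ⟨h.1 v hv, h.2 v hv⟩
  rw [hall, Measure.prod_prod, Measure.pi_pi_finset, Measure.pi_pi_finset,
    ← Finset.prod_mul_distrib]
  exact (Finset.prod_congr rfl hone).symm

end RandomInput

namespace Protocol

variable {V M : Type*} {Ω : V → Type*} {Δ : ℕ} [MeasurableSpace M]
  [∀ u, MeasurableSpace (Ω u)] {P : Protocol V (Fin (Δ + 1)) M Ω}

section

variable [DecidableEq V]

/-- The information in the messages crossing the boundary of `Q`, for inputs given by random
bits. -/
abbrev bitCrossing (P : Protocol V (Fin (Δ + 1)) M Ω) (U : Finset V) (Q : Set V) :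
    MeasurableSpace ((V → Bool) × ∀ u, Ω u) :=
  P.crossing (fun θ => bitInput Δ U θ.1) (fun θ => θ.2) Q P.rounds

theorem measurable_bitInput_privateInfo (U : Finset V) (v : V) :
    Measurable[privateInfo Ω v] fun θ : (V → Bool) × ∀ u, Ω u => bitInput Δ U θ.1 v :=
  (measurable_of_finite fun c : Bool => if v ∈ U ∧ c then Fin.last Δ else 0).comp
    (measurable_fst_privateInfo v)

theorem bitCrossing_le (U : Finset V) (Q : Set V) :
    P.bitCrossing U Q ≤ Prod.instMeasurableSpace :=
  crossing_le_of_le (measurable_bitInput_privateInfo U) measurable_snd_privateInfo privateInfo_le _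

/-- The messages crossing the boundary of `Q` occur in the joint view of the complement of `Q`. -/
theorem bitCrossing_le_comap_viewOn (U : Finset V) (Q : Set V) :
    P.bitCrossing U Q ≤ MeasurableSpace.comap
      (fun θ : (V → Bool) × ∀ u, Ω u => P.viewOn Qᶜ (bitInput Δ U θ.1) θ.2) inferInstance := by
  refine crossing_le fun r hr i j hij => ?_
  have hview := comap_measurable (m := MeasurableSpace.pi)
    (fun θ : (V → Bool) × ∀ u, Ω u => P.viewOn Qᶜ (bitInput Δ U θ.1) θ.2)
  by_cases hi : i ∈ Q
  · have hj : j ∈ Qᶜ := fun hj => hij (iff_of_true hi hj)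
    have hm : Measurable fun y : (Qᶜ : Set V) →
        Fin (Δ + 1) × (Fin P.rounds → V → M) × (Fin P.rounds → V → M) =>
          (y ⟨j, hj⟩).2.2 ⟨r, hr⟩ i := by fun_prop
    exact hm.comp hview
  · have hm : Measurable fun y : (Qᶜ : Set V) →
        Fin (Δ + 1) × (Fin P.rounds → V → M) × (Fin P.rounds → V → M) =>
          (y ⟨i, hi⟩).2.1 ⟨r, hr⟩ j := by fun_prop
    exact hm.comp hview

end

variable [Fintype V]

instance : IsProbabilityMeasure P.law := by unfold law; infer_instance

/-- The joint law of independent fair bits and of the coins of the protocol. -/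
noncomputable def bitLaw (P : Protocol V (Fin (Δ + 1)) M Ω) :
    Measure ((V → Bool) × ∀ u, Ω u) :=
  (Measure.pi fun _ => fairCoin).prod P.law

instance : IsProbabilityMeasure P.bitLaw := by unfold bitLaw; infer_instance

theorem bitLaw_real_eq_half (u : V) :
    P.bitLaw.real {θ : (V → Bool) × ∀ u, Ω u | θ.1 u = true} = 1 / 2 := by
  have h1 := Measure.pi_pi_finset (μ := fun _ : V => fairCoin) (fun _ => {true}) {u}
  simp only [Finset.coe_singleton, Set.singleton_pi, Finset.prod_singleton,
    fairCoin_singleton] at h1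
  have e : {θ : (V → Bool) × ∀ u, Ω u | θ.1 u = true} =
      ((fun b : V → Bool => b u) ⁻¹' {true}) ×ˢ Set.univ := by
    ext θ; simp
  rw [measureReal_def, e, bitLaw, Measure.prod_prod]
  erw [h1]
  simp

variable [DecidableEq V]

/-- Privacy in Bayesian form: no event about the messages crossing the boundary of `N[u] \ T` makes
the input `Δ` of `u` more than `exp ε` times as likely as the input `0`. -/
theorem bitLaw_inter_le {ε : ℝ} {G : SimpleGraph V} {t : V → ℕ} (hP : IsRTGDP P ε 0 G t)
    {U : Finset V} {u : V} (hu : u ∈ U) {T : Finset V} (hT : (T : Set V) ⊆ G.neighborSet u)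
    (hTt : T.card ≤ t u) {c : Set ((V → Bool) × ∀ u, Ω u)}
    (hc : MeasurableSet[P.bitCrossing U (closedNeighborSet G u \ T)] c) :
    P.bitLaw ({θ | θ.1 u = true} ∩ c) ≤
      ENNReal.ofReal (Real.exp ε) * P.bitLaw ({θ | θ.1 u = true}ᶜ ∩ c) := by
  have hc0 : MeasurableSet c := bitCrossing_le U _ c hc
  have hs0 := privateInfo_le u _ (measurableSet_bit (Ω := Ω) u)
  obtain ⟨S, hS, hSc⟩ := bitCrossing_le_comap_viewOn U _ c hc
  let φ : (V → Bool) → ENNReal := fun b => P.law (Prod.mk b ⁻¹' c)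
  have hφ : ∀ b, φ b = P.law {ω |
      P.viewOn (closedNeighborSet G u \ (T : Set V))ᶜ (bitInput Δ U b) ω ∈ S} := fun b => by
    simp only [φ, ← hSc]
    rfl
  let f : (V → Bool) → ENNReal := fun b => if b u = true then 0 else φ b
  have hdp : ∀ b : V → Bool, (if b u = true then φ b else 0) ≤
      ENNReal.ofReal (Real.exp ε) * f (Function.update b u (!b u)) := by
    intro b
    by_cases hb : b u = true
    · have h := hP u T hT hTt (bitInput Δ U b) (Fin.last Δ) 0 S hS
      have e1 : Function.update (bitInput Δ U b) u (Fin.last Δ) = bitInput Δ U b := by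
        rw [Function.update_eq_self_iff]; simp [bitInput, hu, hb]
      have e2 : Function.update (bitInput Δ U b) u 0 =
          bitInput Δ U (Function.update b u (!b u)) := by
        rw [bitInput_update b hu, hb]; simp
      rw [e1, e2, ENNReal.ofReal_zero, add_zero, ← hφ, ← hφ] at h
      simpa [f, hb] using h
    · simp [hb]
  have hleft : P.bitLaw ({θ | θ.1 u = true} ∩ c) =
        ∫⁻ b, (if b u = true then φ b else 0) ∂(Measure.pi fun _ => fairCoin) := by
    rw [bitLaw, Measure.prod_apply (hs0.inter hc0)]
    refine lintegral_congr fun b => ?_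
    by_cases hb : b u = true <;> simp [hb, φ, Set.preimage]
  have hright : P.bitLaw ({θ | θ.1 u = true}ᶜ ∩ c) =
        ∫⁻ b, f b ∂(Measure.pi fun _ => fairCoin) := by
    rw [bitLaw, Measure.prod_apply (hs0.compl.inter hc0)]
    refine lintegral_congr fun b => ?_
    by_cases hb : b u = true <;> simp [hb, f, φ, Set.preimage]
  rw [hleft, hright, ← (measurePreserving_update_not u).lintegral_comp (measurable_of_finite f),
    ← lintegral_const_mul _ (measurable_of_finite _)]
  exact lintegral_mono hdp

end Protocol

end TrustGraph

/-! ### Robust packings -/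

namespace TrustGraph

variable {V : Type*} {G : SimpleGraph V} {t : V → ℕ}

theorem IsRobustPacking.mono {U U' : Finset V} {T : V → Finset V} (h : IsRobustPacking G t U T)
    (hU : U' ⊆ U) : IsRobustPacking G t U' T :=
  ⟨fun u hu => h.1 u (hU hu), h.2.subset (Finset.coe_subset.2 hU)⟩

theorem exists_isRobustPacking_card_eq [Fintype V] (G : SimpleGraph V) (t : V → ℕ) :
    ∃ (U : Finset V) (T : V → Finset V), IsRobustPacking G t U T ∧
      U.card = robustPackingNumber G t := by
  refine Nat.sSup_mem (s := {k | ∃ (U : Finset V) (T : V → Finset V),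
    IsRobustPacking G t U T ∧ U.card = k}) ⟨0, ∅, fun _ => ∅, ⟨by simp, by simp⟩, rfl⟩ ?_
  refine ⟨Fintype.card V, ?_⟩
  rintro _ ⟨U, T, _, rfl⟩
  exact U.card_le_univ

/-- A vertex `w` lies in at most one of the sets of a packing. So, if some single set of the form
`N[v] \ T` avoids `w`, at least half of the packing number is attained by sets that avoid `w`. -/
theorem exists_isRobustPacking_notMem [Fintype V] [DecidableEq V] (w : V)
    (hw : ∃ v, v ≠ w ∧ (¬ G.Adj v w ∨ 1 ≤ t v)) :
    ∃ (U : Finset V) (T : V → Finset V), IsRobustPacking G t U T ∧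
      (∀ u ∈ U, w ∉ closedNeighborSet G u \ (T u : Set V)) ∧
      robustPackingNumber G t ≤ 2 * U.card := by
  classical
  obtain ⟨U, T, hUT, hcard⟩ := exists_isRobustPacking_card_eq G t
  by_cases h2 : 2 ≤ U.card
  · refine ⟨{u ∈ U | w ∉ closedNeighborSet G u \ (T u : Set V)}, T,
      hUT.mono (Finset.filter_subset _ _), fun u hu => (Finset.mem_filter.1 hu).2, ?_⟩
    have h1 : (U.filter fun u => ¬ w ∉ closedNeighborSet G u \ (T u : Set V)).card ≤ 1 := by
      refine Finset.card_le_one.2 fun u hu v hv => by_contra fun huv => ?_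
      rw [Finset.mem_filter, not_not] at hu hv
      exact Set.disjoint_left.1 (hUT.2 hu.1 hv.1 huv) hu.2 hv.2
    have hsum := Finset.card_filter_add_card_filter_not (s := U)
      (fun u => w ∉ closedNeighborSet G u \ (T u : Set V))
    omega
  · obtain ⟨v, hvw, hv⟩ := hw
    refine ⟨{v}, fun _ => if G.Adj v w then {w} else ∅, ⟨?_, by simp⟩, ?_, by simp; omega⟩
    · intro u hu
      rw [Finset.mem_singleton.1 hu]
      by_cases h : G.Adj v w
      · simpa [h] using hv
      · simp [h]
    · intro u hu
      rw [Finset.mem_singleton.1 hu]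
      by_cases h : G.Adj v w
      · simp [h]
      · simp [h, closedNeighborSet, hvw.symm]

/-! ### The lower bound -/

variable {M : Type*} {Ω : V → Type*} {Δ : ℕ} [Fintype V] [DecidableEq V] [MeasurableSpace M]
  [∀ u, MeasurableSpace (Ω u)] {P : Protocol V (Fin (Δ + 1)) M Ω}

/-- The lower bound for the square error averaged over random bits as inputs, for an estimate that is
square integrable. -/
theorem Protocol.le_integral_bitLaw {ε : ℝ} (hP : IsRTGDP P ε 0 G t) {U : Finset V}
    {T : V → Finset V} (hUT : IsRobustPacking G t U T)
    (hw : ∀ u ∈ U, P.outVertex ∉ closedNeighborSet G u \ (T u : Set V))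
    (ha : MemLp (fun θ : (V → Bool) × ∀ u, Ω u => P.estimate (bitInput Δ U θ.1) θ.2) 2 P.bitLaw) :
    1 / 2 / (Real.exp ε + 1) * (Δ : ℝ) ^ 2 * U.card ≤
      ∫ θ, (P.estimate (bitInput Δ U θ.1) θ.2 - ∑ v, ((bitInput Δ U θ.1 v : ℕ) : ℝ)) ^ 2
        ∂P.bitLaw := by
  set Q : V → Set V := fun u => closedNeighborSet G u \ (T u : Set V) with hQ
  set b : V → (V → Bool) × (∀ u, Ω u) → ℝ := fun u =>
    {θ | θ.1 u = true}.indicator fun _ => (1 : ℝ) with hb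
  set p : V → (V → Bool) × (∀ u, Ω u) → ℝ := fun u => P.bitLaw[b u | P.bitCrossing U (Q u)] with hp
  have hmem : ∀ u, u ∈ U → u ∈ Q u := fun u hu =>
    ⟨Set.mem_insert u _, fun h => G.loopless.irrefl u ((hUT.1 u hu).1 h)⟩
  have hx := measurable_bitInput_privateInfo (Ω := Ω) (Δ := Δ) U
  have hη := measurable_snd_privateInfo (Ω := Ω)
  have hF := privateInfo_le (Ω := Ω)
  have hbm : ∀ (m : MeasurableSpace ((V → Bool) × ∀ u, Ω u)) (v : V), privateInfo Ω v ≤ m →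
      StronglyMeasurable[m] (b v) := fun m v hm =>
    (@stronglyMeasurable_const _ _ m _ _).indicator (hm _ (measurableSet_bit v))
  have hb2 : ∀ u, MemLp (b u) 2 P.bitLaw := fun u =>
    (memLp_const (1 : ℝ)).indicator (hF u _ (measurableSet_bit u))
  have hp2 : ∀ u, MemLp (p u) 2 P.bitLaw := fun u => (hb2 u).condExp one_le_two
  have hsum : ∀ θ : (V → Bool) × (∀ u, Ω u), ∑ v, ((bitInput Δ U θ.1 v : ℕ) : ℝ) =
      Δ * ∑ u ∈ U, b u θ := fun θ => by
    rw [sum_bitInput]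
    simp only [hb, Set.indicator_apply, Set.mem_ofPred_eq]
  have hvar : ∀ u ∈ U, 1 / 2 / (Real.exp ε + 1) ≤ ∫ θ, (b u θ - p u θ) ^ 2 ∂P.bitLaw :=
    fun u hu => by
      have := div_le_integral_indicator_sub_sq (μ := P.bitLaw) (bitCrossing_le U (Q u))
        (hF u _ (measurableSet_bit u)) (Real.exp_pos ε)
        (fun c hc => bitLaw_inter_le hP hu (hUT.1 u hu).1 (hUT.1 u hu).2 hc)
        stronglyMeasurable_condExp (hp2 u)
      rwa [bitLaw_real_eq_half] at this
  have hmain := sq_mul_sum_integral_sq_le (μ := P.bitLaw) (U := U) (b := b) (p := p)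
    (m := fun u => coalition (privateInfo Ω) (Q u)ᶜ ⊔ P.bitCrossing U (Q u)) (Δ : ℝ)
    (fun u _ => sup_le (coalition_le hF _) (bitCrossing_le U _)) ha (fun u _ => hb2 u)
    (fun u hu => by
      have := measurable_estimate (P := P) (Q := (Q u)ᶜ) hx hη (hw u hu)
      rw [crossing_compl] at this
      exact this.stronglyMeasurable)
    (fun u hu v hv hvu => hbm _ v ((le_coalition _
      ((hUT.2 hv hu hvu).notMem_of_mem_left (hmem v hv))).trans le_sup_left))
    -- What crosses the boundary of `Q v` is seen outside `Q u`, as the two sets are disjoint.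
    (fun u hu v hv => by
      refine StronglyMeasurable.mono (stronglyMeasurable_condExp (m := P.bitCrossing U (Q v))) ?_
      by_cases hvu : v = u
      · subst hvu; exact le_sup_right
      · exact crossing_le_coalition_compl_sup hx hη (hUT.2 hv hu hvu) _)
    (fun u hu => condIndepGiven_crossing hx hη hF (iIndep_privateInfo _ _) P.rounds _
      (le_coalition _ (hmem u hu) _ (measurableSet_bit u)))
  simp_rw [hsum]
  refine le_trans ?_ hmain
  rw [mul_comm _ ((Δ : ℝ) ^ 2), mul_assoc]
  refine mul_le_mul_of_nonneg_left ?_ (sq_nonneg _)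
  have := Finset.card_nsmul_le_sum U _ _ hvar
  rwa [nsmul_eq_mul, mul_comm] at this

/-- Some input is at least as bad as the average; an estimate that is not square integrable has
infinite error on some input. -/
theorem Protocol.exists_le_mse {ε : ℝ} (hP : IsRTGDP P ε 0 G t) {U : Finset V}
    {T : V → Finset V} (hUT : IsRobustPacking G t U T)
    (hw : ∀ u ∈ U, P.outVertex ∉ closedNeighborSet G u \ (T u : Set V)) :
    ∃ x, ENNReal.ofReal (1 / 2 / (Real.exp ε + 1) * (Δ : ℝ) ^ 2 * U.card) ≤ mse P x := by
  by_contra! hlt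
  have hest : Measurable fun θ : (V → Bool) × ∀ u, Ω u =>
      P.estimate (bitInput Δ U θ.1) θ.2 := by
    refine (measurable_estimate (P := P) (Q := Set.univ)
      (measurable_bitInput_privateInfo (Ω := Ω) U)
      measurable_snd_privateInfo (Set.mem_univ _)).mono ?_ le_rfl
    exact sup_le (coalition_le privateInfo_le _) (bitCrossing_le U _)
  have hsum : Measurable fun θ : (V → Bool) × ∀ u, Ω u =>
      ∑ v, ((bitInput Δ U θ.1 v : ℕ) : ℝ) :=
    (measurable_of_finite fun b : V → Bool => ∑ v, ((bitInput Δ U b v : ℕ) : ℝ)).comp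
      measurable_fst
  set D : (V → Bool) × (∀ u, Ω u) → ℝ := fun θ =>
    P.estimate (bitInput Δ U θ.1) θ.2 - ∑ v, ((bitInput Δ U θ.1 v : ℕ) : ℝ) with hD
  have hDm : Measurable D := hest.sub hsum
  have hfub : ∫⁻ θ, ENNReal.ofReal (D θ ^ 2) ∂P.bitLaw =
      ∫⁻ b, mse P (bitInput Δ U b) ∂(Measure.pi fun _ => fairCoin) :=
    lintegral_prod _ (hDm.pow_const 2).ennreal_ofReal.aemeasurable
  have hfin : ∫⁻ θ, ENNReal.ofReal (D θ ^ 2) ∂P.bitLaw < ⊤ := by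
    rw [hfub]
    refine (lintegral_mono fun b => (hlt (bitInput Δ U b)).le).trans_lt ?_
    simp
  have hD2 : MemLp D 2 P.bitLaw := by
    rw [memLp_two_iff_integrable_sq hDm.aestronglyMeasurable]
    refine ⟨(hDm.pow_const 2).aestronglyMeasurable, ?_⟩
    rw [hasFiniteIntegral_iff_ofReal (Filter.Eventually.of_forall fun θ => sq_nonneg _)]
    exact hfin
  have hsum2 : MemLp (fun θ : (V → Bool) × ∀ u, Ω u =>
      ∑ v, ((bitInput Δ U θ.1 v : ℕ) : ℝ)) 2 P.bitLaw := by
    refine memLp_finsetSum _ fun v _ => ?_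
    refine MemLp.of_bound ?_ Δ (Filter.Eventually.of_forall fun θ => ?_)
    · exact ((measurable_of_finite fun b : V → Bool => ((bitInput Δ U b v : ℕ) : ℝ)).comp
        measurable_fst).aestronglyMeasurable
    · rw [Real.norm_natCast]
      exact_mod_cast Fin.is_le _
  have ha : MemLp (fun θ : (V → Bool) × ∀ u, Ω u =>
      P.estimate (bitInput Δ U θ.1) θ.2) 2 P.bitLaw := by
    convert hD2.add hsum2 using 1
    ext θ
    simp [hD]
  have hint := le_integral_bitLaw hP hUT hw ha
  have hle := ENNReal.ofReal_le_ofReal hint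
  rw [ofReal_integral_eq_lintegral_ofReal hD2.integrable_sq
    (Filter.Eventually.of_forall fun θ => sq_nonneg _)] at hle
  obtain ⟨b, hb⟩ := exists_lintegral_le (hfub ▸ hfin.ne)
  exact absurd (hle.trans (hfub.le.trans hb)) (hlt _).not_ge

end TrustGraph

theorem mainTheorem4 (ε₀ : ℝ) :
    ∃ c : ℝ, 0 < c ∧
      ∀ (V M : Type*) (Ω : V → Type*) [Fintype V] [DecidableEq V] [MeasurableSpace M]
        [∀ u, MeasurableSpace (Ω u)] (G : SimpleGraph V) (t : V → ℕ) (Δ : ℕ) (ε : ℝ)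
        (P : TrustGraph.Protocol V (Fin (Δ + 1)) M Ω),
        ε ≤ ε₀ →
        TrustGraph.IsRTGDP P ε 0 G t →
        -- the vertex that computes the estimate is not unconditionally trusted by all others
        (∃ v, v ≠ P.outVertex ∧ (¬ G.Adj v P.outVertex ∨ 1 ≤ t v)) →
        ∃ x : V → Fin (Δ + 1),
          ENNReal.ofReal (c * (Δ : ℝ) ^ 2 * (TrustGraph.robustPackingNumber G t : ℝ)) ≤
            TrustGraph.mse P x := by
  have hpos := Real.exp_pos ε₀
  refine ⟨1 / 4 / (Real.exp ε₀ + 1), by positivity, ?_⟩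
  intro V M Ω _ _ _ _ G t Δ ε P hε hP hw
  obtain ⟨U, T, hUT, hwU, hcard⟩ :=
    TrustGraph.exists_isRobustPacking_notMem (G := G) (t := t) P.outVertex hw
  obtain ⟨x, hx⟩ := TrustGraph.Protocol.exists_le_mse hP hUT hwU
  refine ⟨x, (ENNReal.ofReal_le_ofReal ?_).trans hx⟩
  have hcard' : (TrustGraph.robustPackingNumber G t : ℝ) ≤ 2 * U.card := by exact_mod_cast hcard
  have hexp : 1 / 2 / (Real.exp ε₀ + 1) ≤ 1 / 2 / (Real.exp ε + 1) := by gcongr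
  calc 1 / 4 / (Real.exp ε₀ + 1) * (Δ : ℝ) ^ 2 * (TrustGraph.robustPackingNumber G t : ℝ)
      ≤ 1 / 4 / (Real.exp ε₀ + 1) * (Δ : ℝ) ^ 2 * (2 * U.card) := by gcongr
    _ = 1 / 2 / (Real.exp ε₀ + 1) * (Δ : ℝ) ^ 2 * U.card := by ring
    _ ≤ 1 / 2 / (Real.exp ε + 1) * (Δ : ℝ) ^ 2 * U.card := by gcongr
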